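/- A modal algebra is a Boolean algebra $A$ with an operation $\Diamond$ satisfying $\Diamond 0=0$ and $\Diamond(a\vee b)=\Diamond a\vee\Diamond b$; put $\Box a=\neg\Diamond\neg a$. It is of finite height if $\Box^{n+1}0=1$ for some $n\in\omega$. For modal algebras $A,B$ and $D\subseteq A$, a stable embedding $A\hookrightarrow_D B$ is an injective Boolean homomorphism $h:A\to B$ with $\Diamond h(a)\le h(\Diamond a)$ for all $a\in A$ and $h(\Diamond a)=\Diamond h(a)$ for all $a\in D$. A (modal multi-conclusion) rule $\Gamma/\Delta$ is a pair of finite sets of modal formulas over countably many propositional variables; it is valid in a modal algebra $A$ if every valuation in $A$ that gives all of $\Gamma$ the value $1$ gives some member of $\Delta$ the value $1$, and otherwise it is refuted in $A$. A rule system is a set $\mathcal S$ of rules that contains $\varphi/\varphi$, $\;\varphi,\varphi\to\psi/\psi$, $\;\varphi/\Box\varphi$ and $/\theta$ for all formulas $\varphi,\psi$ and all theorems $\theta$ of the least normal modal logic $\mathsf K$, and is closed under weakening (from $\Gamma/\Delta$ to $\Gamma\cup\Gamma'/\Delta\cup\Delta'$), cut (from $\Gamma/\Delta,\varphi$ and $\Gamma,\varphi/\Delta$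 to $\Gamma/\Delta$) and uniform substitution. An $\mathcal S$-algebra is a modal algebra in which all rules of $\mathcal S$ are valid. $\mathcal S$ is stable if, whenever $B$ is an $\mathcal S$-algebra and $A$ is a modal algebra with $A\hookrightarrow_\emptyset B$, also $A$ is an $\mathcal S$-algebra. $\mathcal S$ has the finite model property (fmp) if every rule not in $\mathcal S$ is refuted in some finite $\mathcal S$-algebra. For a set $\mathcal R$ of rules, $\mathcal S+\mathcal R$ is the least rule system containing $\mathcal S\cup\mathcal R$. For a finite modal algebra $A$ and $D\subseteq A$, with pairwise distinct variables $p_a$ ($a\in A$), the stable canonical rule $\rho(A,D)$ is $\Gamma/\Delta$ with $$\Gamma=\{p_{a\vee b}\leftrightarrow p_a\vee p_b : a,b\in A\}\cup\{p_{\neg a}\leftrightarrow\neg p_a : a\in A\}\cup\{\Diamond p_a\to p_{\Diamond a} : a\in A\}\cup\{p_{\Diamond a}\to\Diamond p_a : a\in D\},$$ $$\Delta=\{p_a : a\in A,\ a\neq 1\}.$$ **Theorem 4.** Let $\mathcal S$ be a stable rule system. If $\{\rho(A_i,D_i): i\in I\}$ is a set of stable canonical rules where each $A_i$ is a finite modal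 algebra of finite height and $D_i\subseteq A_i$, then the rule system $\mathcal S+\{\rho(A_i,D_i): i\in I\}$ has the fmp. In particular, every stable rule system has the fmp. -/

import Mathlib

/-- A modal algebra: a Boolean algebra with an operation `dia` (`◇`) preserving finite joins. -/
class ModalAlgebra (A : Type*) extends BooleanAlgebra A where
  dia : A → A
  dia_bot : dia ⊥ = ⊥
  dia_sup : ∀ a b : A, dia (a ⊔ b) = dia a ⊔ dia b

namespace ModalAlgebra

/-- The dual operation `□ a = ¬ ◇ ¬ a`. -/
def box {A : Type*} [ModalAlgebra A] (a : A) : A := (dia aᶜ)ᶜ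

/-- `A` is of height `≤ n` when `□ⁿ⁺¹ 0 = 1`. -/
def HeightLE (A : Type*) [ModalAlgebra A] (n : ℕ) : Prop :=
  (box : A → A)^[n + 1] ⊥ = ⊤

/-- `A` is of finite height. -/
def FiniteHeight (A : Type*) [ModalAlgebra A] : Prop := ∃ n : ℕ, HeightLE A n

/-- A Boolean homomorphism `h` is stable when `◇ h(a) ≤ h(◇ a)` for all `a`. -/
def IsStableHom {A B : Type*} [ModalAlgebra A] [ModalAlgebra B]
    (h : BoundedLatticeHom A B) : Prop :=
  ∀ a : A, dia (h a) ≤ h (dia a)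

/-- The closed domain condition for a set `D`. -/
def ClosedDomain {A B : Type*} [ModalAlgebra A] [ModalAlgebra B]
    (h : BoundedLatticeHom A B) (D : Set A) : Prop :=
  ∀ a ∈ D, h (dia a) = dia (h a)

/-- There is a stable embedding of `A` into `B` satisfying the closed domain condition
for `D`. -/
def StablyEmbeds (A B : Type*) [ModalAlgebra A] [ModalAlgebra B] (D : Set A) : Prop :=
  ∃ h : BoundedLatticeHom A B, Function.Injective h ∧ IsStableHom h ∧ ClosedDomain h D

end ModalAlgebra

/-- Modal formulas over the propositional variables `p₀, p₁, …`. -/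
inductive Formula : Type
  | var : ℕ → Formula
  | bot : Formula
  | imp : Formula → Formula → Formula
  | box : Formula → Formula
  deriving DecidableEq

namespace Formula

def neg (φ : Formula) : Formula := imp φ bot
def or (φ ψ : Formula) : Formula := imp (neg φ) ψ
def and (φ ψ : Formula) : Formula := neg (imp φ (neg ψ))
def iff (φ ψ : Formula) : Formula := and (imp φ ψ) (imp ψ φ)
def dia (φ : Formula) : Formula := neg (box (neg φ))

/-- Uniform substitution. -/
def subst (σ : ℕ → Formula) : Formula → Formula
  | var n => σ n
  | bot => bot
  | imp φ ψ => imp (subst σ φ) (subst σ ψ)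
  | box φ => box (subst σ φ)

/-- The value of a formula in a modal algebra under a valuation. -/
def eval {A : Type*} [ModalAlgebra A] (v : ℕ → A) : Formula → A
  | var n => v n
  | bot => ⊥
  | imp φ ψ => (eval v φ)ᶜ ⊔ eval v ψ
  | box φ => ModalAlgebra.box (eval v φ)

/-- Substitution instances of classical propositional tautologies: the formulas that are true
under every assignment of truth values to formulas that respects `⊥` and `→`. -/
def IsTautology (φ : Formula) : Prop :=
  ∀ t : Formula → Prop, ¬ t bot → (∀ ψ χ, t (imp ψ χ) ↔ (t ψ → t χ)) → t φ

/-- The theorems of the least normal modal logic `K`. -/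
inductive KTheorem : Formula → Prop
  | taut {φ : Formula} : IsTautology φ → KTheorem φ
  | distrib (φ ψ : Formula) : KTheorem (imp (box (imp φ ψ)) (imp (box φ) (box ψ)))
  | mp {φ ψ : Formula} : KTheorem (imp φ ψ) → KTheorem φ → KTheorem ψ
  | nec {φ : Formula} : KTheorem φ → KTheorem (box φ)

end Formula

/-- A multi-conclusion modal rule `Γ / Δ`, with `Γ` and `Δ` finite sets of formulas. -/
structure Rule : Type where
  prem : Finset Formula
  concl : Finset Formula

namespace Rule

/-- `A ⊨ Γ / Δ`: every valuation making all of `Γ` equal to `1` makes some member of `Δ`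
equal to `1`. -/
def ValidIn (ρ : Rule) (A : Type*) [ModalAlgebra A] : Prop :=
  ∀ v : ℕ → A, (∀ γ ∈ ρ.prem, γ.eval v = ⊤) → ∃ δ ∈ ρ.concl, δ.eval v = ⊤

end Rule

/-- Normal modal multi-conclusion rule systems. -/
structure IsRuleSystem (S : Set Rule) : Prop where
  refl : ∀ φ : Formula, (⟨{φ}, {φ}⟩ : Rule) ∈ S
  mp : ∀ φ ψ : Formula, (⟨{φ, Formula.imp φ ψ}, {ψ}⟩ : Rule) ∈ S
  nec : ∀ φ : Formula, (⟨{φ}, {Formula.box φ}⟩ : Rule) ∈ S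
  thm : ∀ φ : Formula, Formula.KTheorem φ → (⟨∅, {φ}⟩ : Rule) ∈ S
  weaken : ∀ Γ Δ Γ' Δ' : Finset Formula,
    (⟨Γ, Δ⟩ : Rule) ∈ S → (⟨Γ ∪ Γ', Δ ∪ Δ'⟩ : Rule) ∈ S
  cut : ∀ (Γ Δ : Finset Formula) (φ : Formula),
    (⟨Γ, insert φ Δ⟩ : Rule) ∈ S → (⟨insert φ Γ, Δ⟩ : Rule) ∈ S → (⟨Γ, Δ⟩ : Rule) ∈ S
  subst : ∀ (Γ Δ : Finset Formula) (σ : ℕ → Formula), (⟨Γ, Δ⟩ : Rule) ∈ S →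
    (⟨Γ.image (Formula.subst σ), Δ.image (Formula.subst σ)⟩ : Rule) ∈ S

namespace RuleSystem

/-- `S + R`: the least rule system containing `S ∪ R`. -/
def extend (S R : Set Rule) : Set Rule := ⋂₀ {T | IsRuleSystem T ∧ S ∪ R ⊆ T}

theorem isRuleSystem_extend (S R : Set Rule) : IsRuleSystem (extend S R) where
  refl φ := fun _ hT => hT.1.refl φ
  mp φ ψ := fun _ hT => hT.1.mp φ ψ
  nec φ := fun _ hT => hT.1.nec φ
  thm φ h := fun _ hT => hT.1.thm φ h
  weaken Γ Δ Γ' Δ' h := fun T hT => hT.1.weaken Γ Δ Γ' Δ' (h T hT)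
  cut Γ Δ φ h h' := fun T hT => hT.1.cut Γ Δ φ (h T hT) (h' T hT)
  subst Γ Δ σ h := fun T hT => hT.1.subst Γ Δ σ (h T hT)

/-- `A ⊨ S`, i.e. `A` belongs to the universal class of `S`. -/
def Models (A : Type*) [ModalAlgebra A] (S : Set Rule) : Prop := ∀ ρ ∈ S, ρ.ValidIn A

/-- `S` is stable: its universal class is closed under stable subalgebras. -/
def IsStable (S : Set Rule) : Prop :=
  ∀ (A B : Type) [ModalAlgebra A] [ModalAlgebra B],
    Models B S → ModalAlgebra.StablyEmbeds A B ∅ → Models A S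

/-- The finite model property: every rule outside `S` is refuted in a finite `S`-algebra. -/
def HasFMP (S : Set Rule) : Prop :=
  ∀ ρ : Rule, ρ ∉ S →
    ∃ (A : Type) (_ : ModalAlgebra A), Finite A ∧ Models A S ∧ ¬ ρ.ValidIn A

end RuleSystem

open Formula in
/-- The stable canonical rule `ρ(A, D)` of a finite modal algebra `A` and `D ⊆ A`. The injection
`p` chooses the pairwise distinct propositional variables `p_a`, for `a` in `A`. -/
noncomputable def stableCanonicalRule (A : Type*) [ModalAlgebra A] [Finite A]
    (p : A ↪ ℕ) (D : Set A) : Rule where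
  prem := (Set.toFinite
    ((Set.range fun x : A × A => iff (var (p (x.1 ⊔ x.2))) (or (var (p x.1)) (var (p x.2)))) ∪
      (Set.range fun a : A => iff (var (p aᶜ)) (neg (var (p a)))) ∪
      (Set.range fun a : A => imp (dia (var (p a))) (var (p (ModalAlgebra.dia a)))) ∪
      ((fun a : A => imp (var (p (ModalAlgebra.dia a))) (dia (var (p a)))) '' D))).toFinset
  concl := (Set.toFinite ((fun a : A => var (p a)) '' {a : A | a ≠ ⊤})).toFinset

/-! By algebraic completeness (`exists_models_not_validIn`), a rule outside the extended system is
refuted in some algebra `B` of that system. The question is how to make `B` finite, and the answer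
depends on its height.

If `B` has finite height, every formula is equivalent in it to one of bounded modal depth. Finitely
many values therefore generate a finite modal subalgebra, which inherits validity of all rules.

If `B` has infinite height, the least filtration `L` through the subformula values is finite, still
refutes the rule, and embeds stably in `B`, so stability keeps it an `S`-algebra. If `L` refuted
some `ρ(A i, D i)`, there would be stable homomorphisms `A i → L → B`. But `h (□ᵐ 0) ≤ □ᵐ 0` for
stable `h`, so finite height passes from `A i` to `B`, a contradiction. -/

namespace ModalAlgebra

/-! ### Finite height along stable homomorphisms -/

section

variable {A B : Type*} [ModalAlgebra A] [ModalAlgebra B]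

theorem dia_mono : Monotone (dia : A → A) := fun a b h => by
  rw [← sup_eq_right.2 h, dia_sup]
  exact le_sup_left

theorem box_mono : Monotone (box : A → A) := fun _ _ h =>
  compl_le_compl (dia_mono (compl_le_compl h))

theorem box_top : box (⊤ : A) = ⊤ := by simp [box, dia_bot]

theorem box_inf (a b : A) : box (a ⊓ b) = box a ⊓ box b := by
  simp [box, dia_sup]

theorem dia_eq_compl_box_compl (a : A) : dia a = (box aᶜ)ᶜ := by simp [box]

/-- Dually, stability says `h (□ a) ≤ □ (h a)`; iterate by monotonicity of `□`. -/
theorem map_iterate_box_le {h : BoundedLatticeHom A B} (hh : IsStableHom h) (m : ℕ) :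
    h (box^[m] ⊥) ≤ box^[m] ⊥ := by
  induction m with
  | zero => simp
  | succ m ih =>
    rw [Function.iterate_succ_apply', Function.iterate_succ_apply']
    refine le_trans ?_ (box_mono ih)
    have := hh (box^[m] ⊥ : A)ᶜ
    rw [map_compl'] at this
    simpa only [box, map_compl'] using compl_le_compl this

theorem FiniteHeight.of_isStableHom {h : BoundedLatticeHom A B} (hh : IsStableHom h) :
    FiniteHeight A → FiniteHeight B := by
  rintro ⟨n, hn⟩
  refine ⟨n, top_le_iff.1 ?_⟩
  rw [← map_top h, ← hn]
  exact map_iterate_box_le hh (n + 1)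

end

end ModalAlgebra

/-! ### Finite Boolean subalgebras and least filtrations -/

namespace BooleanSubalgebra

variable {B : Type*}

/-- The sublattice generated by `s`, `⊥` and `⊤` is finite, and each element of the Boolean closure
is a finite join of differences of its elements. -/
theorem finite_closure [BooleanAlgebra B] {s : Set B} (hs : s.Finite) :
    (closure s : Set B).Finite := by
  have hL : (latticeClosure (insert ⊥ (insert ⊤ s))).Finite :=
    ((hs.insert ⊤).insert ⊥).latticeClosure
  have hsub : insert ⊥ (insert ⊤ s) ⊆ latticeClosure (insert ⊥ (insert ⊤ s)) :=
    subset_latticeClosure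
  have := hL.to_subtype
  refine Set.Finite.subset (Set.finite_range
    (fun t : Finset (latticeClosure (insert ⊥ (insert ⊤ s)) ×
      latticeClosure (insert ⊥ (insert ⊤ s))) => t.sup fun x => x.1.1 \ x.2.1)) fun a ha => ?_
  obtain ⟨t, ht⟩ := (mem_closure_iff_sup_sdiff isSublattice_latticeClosure
    (hsub (by simp)) (hsub (by simp))).1
    (closure_mono (fun x hx => hsub (by simp [hx])) ha)
  exact ⟨t, ht.symm⟩

variable [ModalAlgebra B] (L : BooleanSubalgebra B)

/-- The modal algebra on a Boolean subalgebra that is closed under `◇`. -/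
abbrev modalAlgebra (hL : ∀ a ∈ L, ModalAlgebra.dia a ∈ L) : ModalAlgebra L where
  dia a := ⟨ModalAlgebra.dia a, hL a a.2⟩
  dia_bot := Subtype.ext ModalAlgebra.dia_bot
  dia_sup a b := Subtype.ext (ModalAlgebra.dia_sup (a : B) b)

/-- Since `L` is finite, the meet of all its elements above `◇ a` lies in `L`. -/
theorem exists_isLeast_dia_le [Finite L] (a : L) :
    ∃ c : L, IsLeast {b : L | ModalAlgebra.dia (a : B) ≤ b} c := by
  classical
  have := Fintype.ofFinite L
  let s : Finset L := Finset.univ.filter fun b => ModalAlgebra.dia (a : B) ≤ b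
  refine ⟨s.inf id, ?_, fun b hb => Finset.inf_le (f := id) (by simpa [s] using hb)⟩
  refine Finset.inf_induction (p := fun b : L => ModalAlgebra.dia (a : B) ≤ b) ?_ ?_ ?_
  · simp
  · intro b hb c hc
    exact le_inf hb hc
  · intro b hb
    simpa [s] using hb

/-- The least filtration of a modal algebra through a finite Boolean subalgebra. -/
noncomputable abbrev leastFiltration [Finite L] : ModalAlgebra L where
  dia a := (exists_isLeast_dia_le L a).choose
  dia_bot := by
    refine le_bot_iff.1 ((exists_isLeast_dia_le L ⊥).choose_spec.2 ?_)
    simp [ModalAlgebra.dia_bot]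
  dia_sup a b := by
    have ha := (exists_isLeast_dia_le L a).choose_spec
    have hb := (exists_isLeast_dia_le L b).choose_spec
    have hab := (exists_isLeast_dia_le L (a ⊔ b)).choose_spec
    have h : ModalAlgebra.dia ((a ⊔ b : L) : B)
        = ModalAlgebra.dia (a : B) ⊔ ModalAlgebra.dia (b : B) := ModalAlgebra.dia_sup _ _
    refine le_antisymm (hab.2 ?_) (sup_le (ha.2 ?_) (hb.2 ?_))
    · rw [Set.mem_ofPred_eq, h]
      exact sup_le_sup ha.1 hb.1
    · exact le_sup_left.trans (h.ge.trans hab.1)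
    · exact le_sup_right.trans (h.ge.trans hab.1)

theorem dia_le_leastFiltration_dia [Finite L] (a : L) :
    ModalAlgebra.dia (a : B) ≤ (L.leastFiltration.dia a : L) :=
  (exists_isLeast_dia_le L a).choose_spec.1

/-- This closed domain condition lets the filtration preserve the values of boxed subformulas. -/
theorem leastFiltration_dia_eq [Finite L] (a : L) (ha : ModalAlgebra.dia (a : B) ∈ L) :
    ((L.leastFiltration.dia a : L) : B) = ModalAlgebra.dia (a : B) :=
  le_antisymm ((exists_isLeast_dia_le L a).choose_spec.2
    (show ModalAlgebra.dia (a : B) ≤ (⟨_, ha⟩ : L) from le_rfl)) (dia_le_leastFiltration_dia L a)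

end BooleanSubalgebra

/-! ### Soundness of the algebraic semantics -/

namespace Formula

section

variable {A : Type*} [ModalAlgebra A] (v : ℕ → A)

theorem eval_imp_eq_top {φ ψ : Formula} : (imp φ ψ).eval v = ⊤ ↔ φ.eval v ≤ ψ.eval v := by
  rw [eval, sup_comm, ← himp_eq, himp_eq_top_iff]

theorem eval_neg (φ : Formula) : (neg φ).eval v = (φ.eval v)ᶜ := by simp [neg, eval]

theorem eval_or (φ ψ : Formula) : (or φ ψ).eval v = φ.eval v ⊔ ψ.eval v := by
  simp [or, eval, eval_neg]

theorem eval_and (φ ψ : Formula) : (and φ ψ).eval v = φ.eval v ⊓ ψ.eval v := by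
  simp [and, eval, eval_neg]

theorem eval_iff_eq_top {φ ψ : Formula} : (iff φ ψ).eval v = ⊤ ↔ φ.eval v = ψ.eval v := by
  rw [iff, eval_and, inf_eq_top_iff, eval_imp_eq_top, eval_imp_eq_top, le_antisymm_iff]

theorem eval_dia (φ : Formula) : (dia φ).eval v = ModalAlgebra.dia (φ.eval v) := by
  rw [dia, eval_neg, eval, eval_neg, ModalAlgebra.dia_eq_compl_box_compl]

theorem eval_subst (σ : ℕ → Formula) (φ : Formula) :
    (φ.subst σ).eval v = φ.eval fun n => (σ n).eval v := by
  induction φ with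
  | var n => rfl
  | bot => rfl
  | imp φ ψ h₁ h₂ => simp only [subst, eval, h₁, h₂]
  | box φ h => simp only [subst, eval, h]

theorem eval_map {B : Type*} [ModalAlgebra B] (f : BoundedLatticeHom A B)
    (hf : ∀ a, f (ModalAlgebra.dia a) = ModalAlgebra.dia (f a)) (φ : Formula) :
    f (φ.eval v) = φ.eval fun n => f (v n) := by
  induction φ with
  | var n => rfl
  | bot => exact map_bot f
  | imp φ ψ h₁ h₂ => simp only [eval, map_sup, map_compl', h₁, h₂]
  | box φ h => simp only [eval, ModalAlgebra.box, map_compl', hf, h]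

/-- A value below `⊤` lies in a prime ideal `J`; calling a formula true when its value is outside
`J` gives a truth assignment that falsifies `φ`. -/
theorem IsTautology.eval_eq_top {φ : Formula} (hφ : IsTautology φ) : φ.eval v = ⊤ := by
  by_contra hne
  have hdis : Disjoint ((Order.PFilter.principal (⊤ : A) : Order.PFilter A) : Set A)
      (Order.Ideal.principal (φ.eval v) : Order.Ideal A) := by
    rw [Set.disjoint_left]
    intro x hx hx'
    have h1 : ⊤ ≤ x := hx
    have h2 : x ≤ φ.eval v := hx'
    exact hne (top_le_iff.1 (h1.trans h2))
  obtain ⟨J, hJ, hIJ, -⟩ := DistribLattice.prime_ideal_of_disjoint_filter_ideal hdis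
  have hmem : φ.eval v ∈ J := hIJ (show φ.eval v ≤ φ.eval v from le_rfl)
  have hcompl : ∀ x : A, xᶜ ∈ J ↔ x ∉ J := fun x =>
    ⟨fun h h' => hJ.toIsProper.top_notMem (by simpa using J.sup_mem h h'),
      hJ.compl_mem_of_notMem⟩
  refine hφ (fun ψ => ψ.eval v ∉ J) (fun h => h J.bot_mem) (fun ψ χ => ?_) hmem
  simp only [eval, Order.Ideal.sup_mem_iff, hcompl]
  tauto

theorem KTheorem.eval_eq_top {φ : Formula} (hφ : KTheorem φ) : φ.eval v = ⊤ := by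
  induction hφ with
  | taut h => exact h.eval_eq_top v
  | distrib φ ψ =>
    rw [eval_imp_eq_top]
    simp only [eval]
    rw [sup_comm, ← himp_eq, sup_comm, ← himp_eq, le_himp_iff, ← ModalAlgebra.box_inf]
    refine ModalAlgebra.box_mono ?_
    exact himp_inf_le
  | mp _ _ h₁ h₂ => exact top_le_iff.1 (h₂ ▸ (eval_imp_eq_top v).1 h₁)
  | nec _ h => rw [eval, h, ModalAlgebra.box_top]

end

end Formula

namespace Rule

open Formula

theorem ValidIn.of_injective {A B : Type*} [ModalAlgebra A] [ModalAlgebra B] {ρ : Rule}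
    (f : BoundedLatticeHom A B) (hinj : Function.Injective f)
    (hf : ∀ a, f (ModalAlgebra.dia a) = ModalAlgebra.dia (f a)) (h : ρ.ValidIn B) :
    ρ.ValidIn A := by
  intro v hv
  obtain ⟨δ, hδ, he⟩ := h (fun n => f (v n)) fun γ hγ => by
    rw [← eval_map v f hf, hv γ hγ, map_top]
  refine ⟨δ, hδ, hinj ?_⟩
  rw [eval_map v f hf, he, map_top]

theorem isRuleSystem_validIn (A : Type*) [ModalAlgebra A] :
    IsRuleSystem {ρ : Rule | ρ.ValidIn A} where
  refl φ v h := ⟨φ, by simp, h φ (by simp)⟩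
  mp φ ψ v h := ⟨ψ, by simp, top_le_iff.1
    ((h φ (by simp)).ge.trans ((eval_imp_eq_top v).1 (h (imp φ ψ) (by simp))))⟩
  nec φ v h := ⟨φ.box, by simp, by rw [eval, h φ (by simp), ModalAlgebra.box_top]⟩
  thm φ h v _ := ⟨φ, by simp, h.eval_eq_top v⟩
  weaken Γ Δ Γ' Δ' h v hv := by
    obtain ⟨δ, hδ, he⟩ := h v fun γ hγ => hv γ (Finset.mem_union_left _ hγ)
    exact ⟨δ, Finset.mem_union_left _ hδ, he⟩
  cut Γ Δ φ h h' v hv := by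
    obtain ⟨δ, hδ, he⟩ := h v hv
    rcases Finset.mem_insert.1 hδ with rfl | hδ
    · refine h' v fun γ hγ => ?_
      rcases Finset.mem_insert.1 hγ with rfl | hγ
      exacts [he, hv γ hγ]
    · exact ⟨δ, hδ, he⟩
  subst Γ Δ σ h v hv := by
    obtain ⟨δ, hδ, he⟩ := h (fun n => (σ n).eval v) fun γ hγ => by
      rw [← eval_subst]
      exact hv _ (Finset.mem_image_of_mem _ hγ)
    exact ⟨δ.subst σ, Finset.mem_image_of_mem _ hδ, by rw [eval_subst, he]⟩

end Rule

/-- The rules valid in `A` form a rule system, so they include the least one over `S ∪ R` once they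
include `S ∪ R`. -/
theorem RuleSystem.models_extend_iff {A : Type*} [ModalAlgebra A] {S R : Set Rule} :
    Models A (extend S R) ↔ Models A S ∧ Models A R := by
  constructor
  · exact fun h => ⟨fun ρ hρ => h ρ fun _ hT => hT.2 (Or.inl hρ),
      fun ρ hρ => h ρ fun _ hT => hT.2 (Or.inr hρ)⟩
  · rintro ⟨hS, hR⟩ ρ hρ
    exact hρ _ ⟨Rule.isRuleSystem_validIn A, Set.union_subset hS hR⟩

/-- The premises say that `a ↦ v (p a)` is a stable homomorphism. Refuting the conclusions would add
injectivity, but finite height transfers without it. -/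
theorem stableCanonicalRule.exists_isStableHom {A B : Type*} [ModalAlgebra A] [Finite A]
    [ModalAlgebra B] {p : A ↪ ℕ} {D : Set A} {v : ℕ → B}
    (hv : ∀ γ ∈ (stableCanonicalRule A p D).prem, γ.eval v = ⊤) :
    ∃ h : BoundedLatticeHom A B, ModalAlgebra.IsStableHom h := by
  have hsup : ∀ a b, v (p (a ⊔ b)) = v (p a) ⊔ v (p b) := fun a b => by
    have := hv (.iff (.var (p (a ⊔ b))) (.or (.var (p a)) (.var (p b))))
      (by simp [stableCanonicalRule])
    rwa [Formula.eval_iff_eq_top, Formula.eval_or] at this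
  have hcompl : ∀ a, v (p aᶜ) = (v (p a))ᶜ := fun a => by
    have := hv (.iff (.var (p aᶜ)) (.neg (.var (p a)))) (by simp [stableCanonicalRule])
    rwa [Formula.eval_iff_eq_top, Formula.eval_neg] at this
  have hdia : ∀ a, ModalAlgebra.dia (v (p a)) ≤ v (p (ModalAlgebra.dia a)) := fun a => by
    have := hv (.imp (.dia (.var (p a))) (.var (p (ModalAlgebra.dia a)))) (by
        rw [stableCanonicalRule, Set.Finite.mem_toFinset]
        exact Or.inl (Or.inr ⟨a, rfl⟩))
    rwa [Formula.eval_imp_eq_top, Formula.eval_dia] at this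
  have htop : v (p ⊤) = ⊤ := by rw [← sup_compl_eq_top (x := (⊤ : A)), hsup, hcompl]; simp
  refine ⟨{ toFun := fun a => v (p a), map_sup' := hsup, map_inf' := fun a b => ?_,
            map_top' := htop, map_bot' := ?_ }, hdia⟩
  · rw [← compl_compl (a ⊓ b), hcompl, compl_inf, hsup, hcompl, hcompl]; simp
  · change v (p ⊥) = ⊥
    rw [← compl_top, hcompl, htop, compl_top]

/-! ### Lindenbaum algebras -/

theorem Formula.subst_var (φ : Formula) : φ.subst Formula.var = φ := by
  induction φ with
  | var n => rfl
  | bot => rfl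
  | imp φ ψ h₁ h₂ => rw [Formula.subst, h₁, h₂]
  | box φ h => rw [Formula.subst, h]

/-- A set of formulas containing the theorems of `K` and closed under modus ponens and
necessitation. -/
structure IsModalTheory (M : Set Formula) : Prop where
  thm : ∀ {φ : Formula}, Formula.KTheorem φ → φ ∈ M
  mp : ∀ {φ ψ : Formula}, φ ∈ M → Formula.imp φ ψ ∈ M → ψ ∈ M
  nec : ∀ {φ : Formula}, φ ∈ M → Formula.box φ ∈ M

namespace IsModalTheory

open Formula

variable {M : Set Formula} (hM : IsModalTheory M)

section

include hM

theorem taut {φ : Formula} (h : IsTautology φ) : φ ∈ M := hM.thm (.taut h)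

theorem taut₁ {φ ψ : Formula} (h : IsTautology (imp φ ψ)) (hφ : φ ∈ M) : ψ ∈ M :=
  hM.mp hφ (hM.taut h)

theorem taut₂ {φ ψ χ : Formula} (h : IsTautology (imp φ (imp ψ χ))) (hφ : φ ∈ M) (hψ : ψ ∈ M) :
    χ ∈ M :=
  hM.mp hψ (hM.taut₁ h hφ)

theorem imp_trans {φ ψ χ : Formula} (h₁ : imp φ ψ ∈ M) (h₂ : imp ψ χ ∈ M) : imp φ χ ∈ M :=
  hM.taut₂ (fun t _ hi => by simp only [hi]; tauto) h₁ h₂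

theorem imp_neg {φ ψ : Formula} (h : imp φ ψ ∈ M) : imp (neg ψ) (neg φ) ∈ M :=
  hM.taut₁ (fun t h0 hi => by simp only [neg, hi]; tauto) h

theorem box_imp {φ ψ : Formula} (h : imp φ ψ ∈ M) : imp (box φ) (box ψ) ∈ M :=
  hM.mp (hM.nec h) (hM.thm (.distrib φ ψ))

theorem dia_imp {φ ψ : Formula} (h : imp φ ψ ∈ M) : imp (dia φ) (dia ψ) ∈ M :=
  hM.imp_neg (hM.box_imp (hM.imp_neg h))

end

/-- The equivalence of formulas modulo a modal theory. -/
def setoid : Setoid Formula where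
  r φ ψ := imp φ ψ ∈ M ∧ imp ψ φ ∈ M
  iseqv := {
    refl := fun φ => ⟨hM.taut fun t _ hi => by simp [hi], hM.taut fun t _ hi => by simp [hi]⟩
    symm := fun h => ⟨h.2, h.1⟩
    trans := fun h h' => ⟨hM.imp_trans h.1 h'.1, hM.imp_trans h'.2 h.2⟩ }

/-- The Lindenbaum algebra of a modal theory. -/
def Lindenbaum : Type := Quotient hM.setoid

namespace Lindenbaum

/-- The class of a formula in the Lindenbaum algebra. -/
def mk (φ : Formula) : hM.Lindenbaum := Quotient.mk hM.setoid φ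

variable {hM}

theorem mk_surjective : Function.Surjective (mk hM) := Quotient.exists_rep

theorem mk_eq_mk {φ ψ : Formula} : mk hM φ = mk hM ψ ↔ imp φ ψ ∈ M ∧ imp ψ φ ∈ M :=
  Quotient.eq (r := hM.setoid)

instance : LE hM.Lindenbaum where
  le := Quotient.lift₂ (fun φ ψ => imp φ ψ ∈ M) fun _ _ _ _ h₁ h₂ => propext
    ⟨fun h => hM.imp_trans h₁.2 (hM.imp_trans h h₂.1),
      fun h => hM.imp_trans h₁.1 (hM.imp_trans h h₂.2)⟩

theorem mk_le_mk {φ ψ : Formula} : mk hM φ ≤ mk hM ψ ↔ imp φ ψ ∈ M := Iff.rfl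

instance : Max hM.Lindenbaum where
  max := Quotient.map₂ or fun _ _ h₁ _ _ h₂ =>
    ⟨hM.taut₂ (fun t h0 hi => by simp only [Formula.or, neg, hi]; tauto) h₁.1 h₂.1,
      hM.taut₂ (fun t h0 hi => by simp only [Formula.or, neg, hi]; tauto) h₁.2 h₂.2⟩

instance : Min hM.Lindenbaum where
  min := Quotient.map₂ and fun _ _ h₁ _ _ h₂ =>
    ⟨hM.taut₂ (fun t h0 hi => by simp only [Formula.and, neg, hi]; tauto) h₁.1 h₂.1,
      hM.taut₂ (fun t h0 hi => by simp only [Formula.and, neg, hi]; tauto) h₁.2 h₂.2⟩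

instance : Compl hM.Lindenbaum where
  compl := Quotient.map neg fun _ _ h => ⟨hM.imp_neg h.2, hM.imp_neg h.1⟩

instance : BooleanAlgebra hM.Lindenbaum where
  le_refl := mk_surjective.forall.2 fun φ => hM.taut fun t _ hi => by simp [hi]
  le_trans := mk_surjective.forall₃.2 fun _ _ _ => hM.imp_trans
  le_antisymm := mk_surjective.forall₂.2 fun _ _ h₁ h₂ => mk_eq_mk.2 ⟨h₁, h₂⟩
  sup := max
  le_sup_left := mk_surjective.forall₂.2 fun _ _ =>
    hM.taut fun t h0 hi => by simp only [Formula.or, neg, hi]; tauto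
  le_sup_right := mk_surjective.forall₂.2 fun _ _ =>
    hM.taut fun t h0 hi => by simp only [Formula.or, neg, hi]; tauto
  sup_le := mk_surjective.forall₃.2 fun _ _ _ =>
    hM.taut₂ fun t h0 hi => by simp only [Formula.or, neg, hi]; tauto
  inf := min
  inf_le_left := mk_surjective.forall₂.2 fun _ _ =>
    hM.taut fun t h0 hi => by simp only [Formula.and, neg, hi]; tauto
  inf_le_right := mk_surjective.forall₂.2 fun _ _ =>
    hM.taut fun t h0 hi => by simp only [Formula.and, neg, hi]; tauto
  le_inf := mk_surjective.forall₃.2 fun _ _ _ =>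
    hM.taut₂ fun t h0 hi => by simp only [Formula.and, neg, hi]; tauto
  le_sup_inf := mk_surjective.forall₃.2 fun _ _ _ =>
    hM.taut fun t h0 hi => by simp only [Formula.or, Formula.and, neg, hi]; tauto
  top := mk hM (neg bot)
  bot := mk hM bot
  le_top := mk_surjective.forall.2 fun _ => hM.taut fun t h0 hi => by simp only [neg, hi]; tauto
  bot_le := mk_surjective.forall.2 fun _ => hM.taut fun t h0 hi => by simp only [hi]; tauto
  inf_compl_le_bot := mk_surjective.forall.2 fun _ =>
    hM.taut fun t h0 hi => by simp only [Formula.and, neg, hi]; tauto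
  top_le_sup_compl := mk_surjective.forall.2 fun _ =>
    hM.taut fun t h0 hi => by simp only [Formula.or, neg, hi]; tauto

theorem mk_eq_top {φ : Formula} : mk hM φ = ⊤ ↔ φ ∈ M := by
  rw [← top_le_iff]
  exact ⟨fun h => hM.taut₁ (fun t h0 hi => by simp only [neg, hi]; tauto) (mk_le_mk.1 h),
    fun h => mk_le_mk.2 (hM.taut₁ (fun t h0 hi => by simp only [neg, hi]; tauto) h)⟩

instance : ModalAlgebra hM.Lindenbaum where
  dia := Quotient.map dia fun _ _ h => ⟨hM.dia_imp h.1, hM.dia_imp h.2⟩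
  dia_bot := le_bot_iff.1 <| mk_le_mk.2 <| by
    have h : box (neg bot) ∈ M := hM.nec (hM.taut fun t h0 hi => by simp only [neg, hi]; tauto)
    exact hM.taut₁ (fun t h0 hi => by simp only [dia, neg, hi]; tauto) h
  dia_sup := mk_surjective.forall₂.2 fun φ ψ => by
    refine le_antisymm ?_ (sup_le ?_ ?_)
    -- With `distrib`, this yields `□¬φ ∧ □¬ψ → □¬(φ ∨ ψ)`, the contrapositive of the goal.
    · have h₁ : imp (box (neg φ)) (box (imp (neg ψ) (neg (or φ ψ)))) ∈ M :=
        hM.box_imp (hM.taut fun t h0 hi => by simp only [Formula.or, neg, hi]; tauto)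
      have h₂ := hM.thm (.distrib (neg ψ) (neg (or φ ψ)))
      exact hM.taut₂ (fun t h0 hi => by simp only [Formula.or, dia, neg, hi]; tauto) h₁ h₂
    · exact hM.dia_imp (hM.taut fun t h0 hi => by simp only [Formula.or, neg, hi]; tauto)
    · exact hM.dia_imp (hM.taut fun t h0 hi => by simp only [Formula.or, neg, hi]; tauto)

theorem box_mk (φ : Formula) : ModalAlgebra.box (mk hM φ) = mk hM (box φ) := by
  change mk hM (neg (neg (box (neg (neg φ))))) = mk hM (box φ)
  have h₁ : imp (box (neg (neg φ))) (box φ) ∈ M :=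
    hM.box_imp (hM.taut fun t h0 hi => by simp only [neg, hi]; tauto)
  have h₂ : imp (box φ) (box (neg (neg φ))) ∈ M :=
    hM.box_imp (hM.taut fun t h0 hi => by simp only [neg, hi]; tauto)
  exact mk_eq_mk.2 ⟨hM.taut₁ (fun t h0 hi => by simp only [neg, hi]; tauto) h₁,
    hM.taut₁ (fun t h0 hi => by simp only [neg, hi]; tauto) h₂⟩

theorem eval_mk (σ : ℕ → Formula) (φ : Formula) :
    φ.eval (fun n => mk hM (σ n)) = mk hM (φ.subst σ) := by
  induction φ with
  | var n => rfl
  | bot => rfl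
  | imp φ ψ h₁ h₂ =>
    rw [eval, h₁, h₂]
    change mk hM (or (neg (φ.subst σ)) (ψ.subst σ)) = mk hM (imp (φ.subst σ) (ψ.subst σ))
    exact mk_eq_mk.2 ⟨hM.taut fun t h0 hi => by simp only [Formula.or, neg, hi]; tauto,
      hM.taut fun t h0 hi => by simp only [Formula.or, neg, hi]; tauto⟩
  | box φ h => rw [eval, h, box_mk, subst]

end Lindenbaum

end IsModalTheory

/-! ### Algebraic completeness -/

namespace IsRuleSystem

open Formula

variable {T : Set Rule} (hT : IsRuleSystem T)

include hT

theorem mono {Γ Δ Γ' Δ' : Finset Formula} (h : (⟨Γ, Δ⟩ : Rule) ∈ T) (hΓ : Γ ⊆ Γ')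
    (hΔ : Δ ⊆ Δ') : (⟨Γ', Δ'⟩ : Rule) ∈ T := by
  simpa [Finset.union_eq_right.2 hΓ, Finset.union_eq_right.2 hΔ] using hT.weaken Γ Δ Γ' Δ' h

/-- The prime theory lemma for multi-conclusion consequence relations. -/
theorem exists_prime {Γ Δ : Finset Formula} (h : (⟨Γ, Δ⟩ : Rule) ∉ T) :
    ∃ M : Set Formula, ↑Γ ⊆ M ∧ (∀ δ ∈ Δ, δ ∉ M) ∧
      ∀ ρ ∈ T, ↑ρ.prem ⊆ M → ∃ δ ∈ ρ.concl, δ ∈ M := by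
  -- `M` is maximal among the sets with no finite part deriving `Δ`; rules have finite premises, so
  -- unions of chains qualify.
  obtain ⟨M, hΓM, hM⟩ := zorn_subset_nonempty
    {X : Set Formula | ∀ Γ' : Finset Formula, ↑Γ' ⊆ X → (⟨Γ', Δ⟩ : Rule) ∉ T} (by
      intro c hc hchain hne
      refine ⟨⋃₀ c, fun Γ' hΓ' => ?_, fun s hs => Set.subset_sUnion_of_mem hs⟩
      obtain ⟨X, hX, hsub⟩ :=
        hchain.directedOn.exists_mem_subset_of_finite_of_subset_sUnion hne Γ'.finite_toSet hΓ'
      exact hc hX Γ' hsub) (Γ : Set Formula)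
    (fun Γ' hΓ' hmem => h (hT.mono hmem (by exact_mod_cast hΓ') subset_rfl))
  have hext : ∀ φ ∉ M, ∃ Γ' : Finset Formula, ↑Γ' ⊆ M ∧ (⟨insert φ Γ', Δ⟩ : Rule) ∈ T := by
    intro φ hφ
    by_contra! hcon
    refine hφ (hM.2 (y := insert φ M) (fun Γ' hΓ' hmem => ?_) (Set.subset_insert _ _)
      (Set.mem_insert _ _))
    refine hcon (Γ'.erase φ) (fun x hx => ?_) (hT.mono hmem ?_ subset_rfl)
    · have hx' := Finset.mem_erase.1 (Finset.mem_coe.1 hx)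
      exact (hΓ' hx'.2).resolve_left hx'.1
    · exact Finset.insert_erase_subset φ Γ'
  -- Each formula outside `M` derives `Δ` together with part of `M`, so cuts remove the members of
  -- `Δ'` one at a time.
  have hcut : ∀ Δ' : Finset Formula, (∀ δ ∈ Δ', δ ∉ M) →
      ∀ Γ' : Finset Formula, ↑Γ' ⊆ M → (⟨Γ', Δ' ∪ Δ⟩ : Rule) ∉ T := by
    intro Δ'
    induction Δ' using Finset.induction_on with
    | empty =>
      intro _ Γ' hΓ'
      rw [Finset.empty_union]
      exact hM.1 Γ' hΓ'
    | insert φ Δ' _ ih =>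
      intro hΔ' Γ' hΓ' hmem
      obtain ⟨Γ'', hΓ'', hmem'⟩ := hext φ (hΔ' φ (Finset.mem_insert_self _ _))
      refine ih (fun δ hδ => hΔ' δ (Finset.mem_insert_of_mem hδ)) (Γ' ∪ Γ'') (by simp [*])
        (hT.cut _ _ φ ?_ ?_)
      · exact hT.mono hmem Finset.subset_union_left (by rw [Finset.insert_union])
      · exact hT.mono hmem' (Finset.insert_subset_insert _ Finset.subset_union_right)
          Finset.subset_union_right
  refine ⟨M, hΓM, fun δ hδ hδM => ?_, fun ρ hρ hsub => ?_⟩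
  · exact hM.1 {δ} (by simpa using hδM) (hT.mono (hT.refl δ) subset_rfl (by simpa using hδ))
  · by_contra! hcon
    exact hcut ρ.concl hcon ρ.prem hsub (hT.mono hρ subset_rfl Finset.subset_union_left)

/-- Algebraic completeness of rule systems. -/
theorem exists_models_not_validIn {ρ : Rule} (h : ρ ∉ T) :
    ∃ (B : Type) (_ : ModalAlgebra B), RuleSystem.Models B T ∧ ¬ ρ.ValidIn B := by
  obtain ⟨M, hΓ, hΔ, hprime⟩ := hT.exists_prime (Γ := ρ.prem) (Δ := ρ.concl) h
  have hM : IsModalTheory M :=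
    { thm := fun {φ} hφ => by simpa using hprime _ (hT.thm φ hφ) (by simp)
      mp := fun {φ ψ} h₁ h₂ => by
        simpa using hprime _ (hT.mp φ ψ) (by simp [Set.insert_subset_iff, h₁, h₂])
      nec := fun {φ} h₁ => by simpa using hprime _ (hT.nec φ) (by simpa using h₁) }
  refine ⟨hM.Lindenbaum, inferInstance, fun τ hτ v hv => ?_, fun hval => ?_⟩
  -- A valuation in the Lindenbaum algebra is a substitution, so closure of `T` under substitution
  -- reduces validity to primeness of `M`.
  · obtain ⟨σ, hσ⟩ := IsModalTheory.Lindenbaum.mk_surjective.comp_left v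
    obtain rfl : (fun n => IsModalTheory.Lindenbaum.mk hM (σ n)) = v := hσ
    simp only [IsModalTheory.Lindenbaum.eval_mk, IsModalTheory.Lindenbaum.mk_eq_top] at hv ⊢
    simpa using hprime _ (hT.subst τ.prem τ.concl σ hτ) (by simpa [Set.subset_def] using hv)
  · obtain ⟨δ, hδ, he⟩ := hval (fun n => IsModalTheory.Lindenbaum.mk hM (var n)) fun γ hγ => by
      rw [IsModalTheory.Lindenbaum.eval_mk, subst_var, IsModalTheory.Lindenbaum.mk_eq_top]
      exact hΓ hγ
    rw [IsModalTheory.Lindenbaum.eval_mk, subst_var, IsModalTheory.Lindenbaum.mk_eq_top] at he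
    exact hΔ δ hδ he

end IsRuleSystem

/-! ### Local finiteness at finite height -/

theorem inf_compl_congr {B : Type*} [BooleanAlgebra B] {a b e : B} (h : a ⊓ e = b ⊓ e) :
    aᶜ ⊓ e = bᶜ ⊓ e := by
  have key : ∀ x : B, xᶜ ⊓ e = (x ⊓ e)ᶜ ⊓ e := fun x => by
    rw [compl_inf, inf_sup_right, compl_inf_self, sup_bot_eq]
  rw [key a, h, ← key b]

namespace Formula

section

variable {B : Type*} [ModalAlgebra B]

/-- The Boolean subalgebras generated by the formulas of modal depth at most `m`. -/
def depthSubalgebra (v : ℕ → B) : ℕ → BooleanSubalgebra B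
  | 0 => BooleanSubalgebra.closure (Set.range v)
  | m + 1 => BooleanSubalgebra.closure
      (Set.range v ∪ ModalAlgebra.box '' (depthSubalgebra v m : Set B))

theorem finite_depthSubalgebra {v : ℕ → B} (hv : (Set.range v).Finite) (m : ℕ) :
    (depthSubalgebra v m : Set B).Finite := by
  induction m with
  | zero => exact BooleanSubalgebra.finite_closure hv
  | succ m ih => exact BooleanSubalgebra.finite_closure (hv.union (ih.image _))

theorem var_mem_depthSubalgebra (v : ℕ → B) (m n : ℕ) : v n ∈ depthSubalgebra v m := by
  cases m with
  | zero => exact BooleanSubalgebra.subset_closure ⟨n, rfl⟩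
  | succ m => exact BooleanSubalgebra.subset_closure (Or.inl ⟨n, rfl⟩)

/-- Below `□ᵐ 0` every formula agrees with one of modal depth at most `m`. -/
theorem exists_mem_depthSubalgebra (v : ℕ → B) (m : ℕ) (φ : Formula) :
    ∃ c ∈ depthSubalgebra v m,
      φ.eval v ⊓ ModalAlgebra.box^[m] ⊥ = c ⊓ ModalAlgebra.box^[m] ⊥ := by
  induction m generalizing φ with
  | zero => exact ⟨⊥, BooleanSubalgebra.bot_mem, by simp⟩
  | succ m ihm =>
    induction φ with
    | var n => exact ⟨v n, var_mem_depthSubalgebra v _ n, rfl⟩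
    | bot => exact ⟨⊥, BooleanSubalgebra.bot_mem, rfl⟩
    | imp φ ψ h₁ h₂ =>
      obtain ⟨c, hc, hce⟩ := h₁
      obtain ⟨d, hd, hde⟩ := h₂
      refine ⟨cᶜ ⊔ d, BooleanSubalgebra.sup_mem (BooleanSubalgebra.compl_mem hc) hd, ?_⟩
      rw [eval, inf_sup_right, inf_sup_right, inf_compl_congr hce, hde]
    -- Here the induction on `m` is used: `□φ ∧ □ᵐ⁺¹0 = □(φ ∧ □ᵐ0)`, so `φ` matters only below
    -- `□ᵐ0`.
    | box φ _ =>
      obtain ⟨c, hc, hce⟩ := ihm φ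
      refine ⟨ModalAlgebra.box c,
        BooleanSubalgebra.subset_closure (Or.inr ⟨c, hc, rfl⟩), ?_⟩
      rw [Function.iterate_succ_apply', eval, ← ModalAlgebra.box_inf, hce, ModalAlgebra.box_inf]

/-- When `□ⁿ⁺¹ 0 = 1`, agreement below it is equality, so all values lie in the finite
`depthSubalgebra v (n + 1)`. -/
theorem finite_range_eval (hB : ModalAlgebra.FiniteHeight B) {v : ℕ → B}
    (hv : (Set.range v).Finite) : (Set.range fun φ : Formula => φ.eval v).Finite := by
  obtain ⟨n, hn⟩ := hB
  refine (finite_depthSubalgebra hv (n + 1)).subset ?_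
  rintro _ ⟨φ, rfl⟩
  obtain ⟨c, hc, h⟩ := exists_mem_depthSubalgebra v (n + 1) φ
  rw [ModalAlgebra.HeightLE] at hn
  rw [hn, inf_top_eq, inf_top_eq] at h
  simpa only [h, SetLike.mem_coe] using hc

/-- The Boolean subalgebra of the values of formulas under a valuation. -/
def evalSubalgebra (v : ℕ → B) : BooleanSubalgebra B where
  carrier := Set.range fun φ : Formula => φ.eval v
  supClosed' := by
    rintro _ ⟨φ, rfl⟩ _ ⟨ψ, rfl⟩
    exact ⟨or φ ψ, eval_or v φ ψ⟩
  infClosed' := by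
    rintro _ ⟨φ, rfl⟩ _ ⟨ψ, rfl⟩
    exact ⟨and φ ψ, eval_and v φ ψ⟩
  compl_mem' := by
    rintro _ ⟨φ, rfl⟩
    exact ⟨neg φ, eval_neg v φ⟩
  bot_mem' := ⟨bot, rfl⟩

theorem dia_mem_evalSubalgebra (v : ℕ → B) :
    ∀ a ∈ evalSubalgebra v, ModalAlgebra.dia a ∈ evalSubalgebra v := by
  rintro _ ⟨φ, rfl⟩
  exact ⟨dia φ, eval_dia v φ⟩

end

/-- The subformulas of a formula. -/
def subformulas : Formula → Finset Formula
  | var n => {var n}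
  | bot => {bot}
  | imp φ ψ => insert (imp φ ψ) (subformulas φ ∪ subformulas ψ)
  | box φ => insert (box φ) (subformulas φ)

theorem mem_subformulas_self (φ : Formula) : φ ∈ φ.subformulas := by
  cases φ <;> simp [subformulas]

theorem subformulas_subset {φ ψ : Formula} (h : φ ∈ ψ.subformulas) :
    φ.subformulas ⊆ ψ.subformulas := by
  induction ψ with
  | var n => rw [Finset.mem_singleton.1 h]
  | bot => rw [Finset.mem_singleton.1 h]
  | imp ψ χ h₁ h₂ =>
    rcases Finset.mem_insert.1 h with rfl | h
    · exact subset_rfl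
    · refine subset_trans ?_ (Finset.subset_insert _ _)
      rcases Finset.mem_union.1 h with h | h
      · exact (h₁ h).trans Finset.subset_union_left
      · exact (h₂ h).trans Finset.subset_union_right
  | box ψ h₁ =>
    rcases Finset.mem_insert.1 h with rfl | h
    · exact subset_rfl
    · exact (h₁ h).trans (Finset.subset_insert _ _)

end Formula

/-! ### Finite refutations -/

namespace Rule

open Formula

/-- The subformulas of the formulas of a rule. -/
def subformulas (ρ : Rule) : Finset Formula := (ρ.prem ∪ ρ.concl).biUnion Formula.subformulas

variable {ρ : Rule}

theorem mem_subformulas_of_prem {φ : Formula} (h : φ ∈ ρ.prem) : φ ∈ ρ.subformulas :=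
  Finset.mem_biUnion.2 ⟨φ, Finset.mem_union_left _ h, mem_subformulas_self φ⟩

theorem mem_subformulas_of_concl {φ : Formula} (h : φ ∈ ρ.concl) : φ ∈ ρ.subformulas :=
  Finset.mem_biUnion.2 ⟨φ, Finset.mem_union_right _ h, mem_subformulas_self φ⟩

theorem subformulas_subset {φ : Formula} (h : φ ∈ ρ.subformulas) :
    φ.subformulas ⊆ ρ.subformulas := by
  obtain ⟨χ, hχ, hφ⟩ := Finset.mem_biUnion.1 h
  exact (Formula.subformulas_subset hφ).trans (Finset.subset_biUnion_of_mem _ hχ)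

theorem of_imp_mem_subformulas {φ ψ : Formula} (h : imp φ ψ ∈ ρ.subformulas) :
    φ ∈ ρ.subformulas ∧ ψ ∈ ρ.subformulas :=
  ⟨subformulas_subset h (by simp [Formula.subformulas, mem_subformulas_self]),
    subformulas_subset h (by simp [Formula.subformulas, mem_subformulas_self])⟩

theorem of_box_mem_subformulas {φ : Formula} (h : box φ ∈ ρ.subformulas) :
    φ ∈ ρ.subformulas :=
  subformulas_subset h (by simp [Formula.subformulas, mem_subformulas_self])

theorem not_validIn_of_injective {A B : Type*} [ModalAlgebra A] [ModalAlgebra B]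
    (f : BoundedLatticeHom A B) (hinj : Function.Injective f) {w : ℕ → A} {v : ℕ → B}
    (hf : ∀ φ ∈ ρ.subformulas, f (φ.eval w) = φ.eval v)
    (hprem : ∀ γ ∈ ρ.prem, γ.eval v = ⊤) (hconcl : ∀ δ ∈ ρ.concl, δ.eval v ≠ ⊤) :
    ¬ ρ.ValidIn A := by
  intro h
  obtain ⟨δ, hδ, he⟩ := h w fun γ hγ => hinj <| by
    rw [hf γ (mem_subformulas_of_prem hγ), hprem γ hγ, map_top]
  refine hconcl δ hδ ?_
  rw [← hf δ (mem_subformulas_of_concl hδ), he, map_top]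

/-- A rule refuted in an algebra of finite height is refuted in a finite subalgebra. -/
theorem exists_finite_subalgebra_not_validIn {B : Type*} [ModalAlgebra B]
    (hB : ModalAlgebra.FiniteHeight B) (h : ¬ ρ.ValidIn B) :
    ∃ (L : BooleanSubalgebra B) (hL : ∀ a ∈ L, ModalAlgebra.dia a ∈ L), Finite L ∧
      ¬ @ValidIn ρ L (L.modalAlgebra hL) := by
  classical
  simp only [ValidIn, not_forall, not_exists, not_and] at h
  obtain ⟨v, hprem, hconcl⟩ := h
  -- Sending the irrelevant variables to `⊥` makes the range finite.
  let v' : ℕ → B := fun n => if var n ∈ ρ.subformulas then v n else ⊥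
  have hv' : (Set.range v').Finite := by
    refine ((ρ.subformulas.finite_toSet.image (Formula.eval v)).insert ⊥).subset ?_
    rintro _ ⟨n, rfl⟩
    by_cases hn : var n ∈ ρ.subformulas
    · exact Or.inr ⟨var n, hn, by simp [v', hn, eval]⟩
    · exact Or.inl (by simp [v', hn])
  have heval : ∀ φ ∈ ρ.subformulas, φ.eval v' = φ.eval v := by
    intro φ
    induction φ with
    | var n => intro hn; simp [v', hn, eval]
    | bot => intro _; rfl
    | imp φ ψ h₁ h₂ =>
      intro hm
      rw [eval, eval, h₁ (of_imp_mem_subformulas hm).1, h₂ (of_imp_mem_subformulas hm).2]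
    | box φ h₁ => intro hm; rw [eval, eval, h₁ (of_box_mem_subformulas hm)]
  refine ⟨evalSubalgebra v', dia_mem_evalSubalgebra v',
    (finite_range_eval hB hv').to_subtype, ?_⟩
  let := (evalSubalgebra v').modalAlgebra (dia_mem_evalSubalgebra v')
  refine not_validIn_of_injective (evalSubalgebra v').subtype
    (evalSubalgebra v').subtype_injective
    (w := fun n => ⟨v' n, var n, rfl⟩) (fun φ hφ => ?_) hprem hconcl
  rw [eval_map _ (evalSubalgebra v').subtype (fun _ => rfl), ← heval φ hφ]
  rfl

/-- A rule refuted in an algebra is refuted in a finite filtration of it. -/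
theorem exists_leastFiltration_not_validIn {B : Type*} [ModalAlgebra B] (h : ¬ ρ.ValidIn B) :
    ∃ (L : BooleanSubalgebra B) (_ : Finite L), ¬ @ValidIn ρ L L.leastFiltration := by
  classical
  simp only [ValidIn, not_forall, not_exists, not_and] at h
  obtain ⟨v, hprem, hconcl⟩ := h
  let L := BooleanSubalgebra.closure (Formula.eval v '' (ρ.subformulas : Set Formula))
  have hmem : ∀ φ ∈ ρ.subformulas, φ.eval v ∈ L := fun φ hφ =>
    BooleanSubalgebra.subset_closure ⟨φ, hφ, rfl⟩
  have hfin : Finite L :=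
    (BooleanSubalgebra.finite_closure (ρ.subformulas.finite_toSet.image _)).to_subtype
  refine ⟨L, hfin, ?_⟩
  let := L.leastFiltration
  let w : ℕ → L := fun n => if hn : var n ∈ ρ.subformulas then ⟨v n, hmem _ hn⟩ else ⊥
  refine not_validIn_of_injective L.subtype L.subtype_injective (w := w) (fun φ => ?_)
    hprem hconcl
  induction φ with
  | var n => intro hn; simp [w, hn, eval]
  | bot => intro _; rfl
  | imp φ ψ h₁ h₂ =>
    intro hm
    rw [eval, eval, map_sup, map_compl', h₁ (of_imp_mem_subformulas hm).1,
      h₂ (of_imp_mem_subformulas hm).2]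
  | box φ h₁ =>
    intro hm
    have h₁ : ((φ.eval w : L) : B) = φ.eval v := h₁ (of_box_mem_subformulas hm)
    -- `◇¬φ` is the complement of the subformula `□φ`, whose value generates `L`, so the filtration
    -- computes it exactly.
    have hdia : ModalAlgebra.dia (((φ.eval w)ᶜ : L) : B) ∈ L := by
      have := BooleanSubalgebra.compl_mem (hmem _ hm)
      rw [eval, ModalAlgebra.box, compl_compl] at this
      rwa [BooleanSubalgebra.val_compl, h₁]
    rw [eval, eval, ModalAlgebra.box, ModalAlgebra.box, map_compl', ← h₁]
    exact congrArg compl (L.leastFiltration_dia_eq _ hdia)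

end Rule

/-! ### The finite model property -/

namespace RuleSystem

variable {S : Set Rule}

theorem models_leastFiltration (hstable : IsStable S) {B : Type} [ModalAlgebra B]
    (hB : Models B S) (L : BooleanSubalgebra B) [Finite L] :
    @Models L L.leastFiltration S := by
  let := L.leastFiltration
  exact hstable L B hB ⟨L.subtype, L.subtype_injective, L.dia_le_leastFiltration_dia,
    fun a ha => ha.elim⟩

theorem hasFMP_extend_stableCanonicalRule (hstable : IsStable S) {I : Type*} (A : I → Type*)
    [∀ i, ModalAlgebra (A i)] [∀ i, Finite (A i)] (p : ∀ i, A i ↪ ℕ) (D : ∀ i, Set (A i))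
    (hA : ∀ i, ModalAlgebra.FiniteHeight (A i)) :
    HasFMP (extend S (Set.range fun i => stableCanonicalRule (A i) (p i) (D i))) := by
  intro ρ hρ
  obtain ⟨B, _, hB, hnot⟩ := (isRuleSystem_extend _ _).exists_models_not_validIn hρ
  by_cases hfin : ModalAlgebra.FiniteHeight B
  · obtain ⟨L, hL, hLfin, hLnot⟩ := Rule.exists_finite_subalgebra_not_validIn hfin hnot
    let := L.modalAlgebra hL
    exact ⟨L, inferInstance, hLfin,
      fun τ hτ => (hB τ hτ).of_injective L.subtype L.subtype_injective fun _ => rfl, hLnot⟩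
  · obtain ⟨L, hLfin, hLnot⟩ := Rule.exists_leastFiltration_not_validIn hnot
    let := L.leastFiltration
    refine ⟨L, inferInstance, hLfin, models_extend_iff.2
      ⟨models_leastFiltration hstable (models_extend_iff.1 hB).1 L, ?_⟩, hLnot⟩
    rintro _ ⟨i, rfl⟩ v hv
    obtain ⟨h, hh⟩ := stableCanonicalRule.exists_isStableHom hv
    -- Finite height travels from `A i` to `L` and on to `B`.
    exact absurd (((hA i).of_isStableHom hh).of_isStableHom
      (h := L.subtype) L.dia_le_leastFiltration_dia) hfin

theorem extend_empty (hS : IsRuleSystem S) : extend S ∅ = S :=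
  Set.Subset.antisymm (Set.sInter_subset_of_mem ⟨hS, by simp⟩)
    (Set.subset_sInter fun _ hT => Set.union_subset_iff.1 hT.2 |>.1)

end RuleSystem

theorem theorem4 (S : Set Rule) (hS : IsRuleSystem S) (hstable : RuleSystem.IsStable S) :
    (∀ (I : Type*) (A : I → Type*) [∀ i, ModalAlgebra (A i)] [∀ i, Finite (A i)]
      (p : ∀ i, A i ↪ ℕ) (D : ∀ i, Set (A i)),
      (∀ i, ModalAlgebra.FiniteHeight (A i)) →
        RuleSystem.HasFMP
          (RuleSystem.extend S (Set.range fun i => stableCanonicalRule (A i) (p i) (D i)))) ∧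
    RuleSystem.HasFMP S := by
  refine ⟨fun I A _ _ p D hA =>
    RuleSystem.hasFMP_extend_stableCanonicalRule hstable A p D hA, ?_⟩
  -- The second claim is the first for the empty family, as `extend S ∅ = S`.
  let : ∀ i : Empty, ModalAlgebra (Empty.elim i : Type) := fun i => i.elim
  have : ∀ i : Empty, Finite (Empty.elim i : Type) := fun i => i.elim
  have h := RuleSystem.hasFMP_extend_stableCanonicalRule hstable
    (fun i : Empty => (Empty.elim i : Type)) (fun i => i.elim) (fun i => i.elim)
    (fun i => i.elim)
  rwa [Set.range_eq_empty, RuleSystem.extend_empty hS] at h
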